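/- **Proposition 3.5.** Let $X$ be a CAT(0) space (not assumed proper or complete) and let $\gamma:\mathbb R\to X$ be a geodesic line, i.e. an isometric embedding. Let $\epsilon,R,L>0$ and let $(t_n)_{n\in\mathbb Z}$ be a strictly increasing family of reals, indexed by all of $\mathbb Z$, such that for every $n\in\mathbb Z$ $$R\le d(\gamma(t_n),\gamma(t_{n+1}))\le L$$ and the open ball $B(\gamma(t_n),\epsilon)$, with the metric induced from $X$, is a CAT($-1$) space. Then $\gamma$ is contracting: there is $B\ge 0$ such that for every ball of $X$ disjoint from $\gamma(\mathbb R)$, the nearest-point projection of this ball onto $\gamma(\mathbb R)$ has diameter at most $B$. Moreover, for every $\delta$ with $0<\delta\le\epsilon$ and $2\delta<R$ one may take $$B=2(\eta(\delta)+2)L+3\delta,\qquad \eta(\delta)=\frac{2\pi}{\pi-4\arccos\sqrt{\dfrac{\cosh\delta}{\cosh\delta+1}}}.$$ -/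

import Mathlib

open Set

namespace PartiallyCAT

/-- `S` is a geodesic segment from `p` to `q`: the image of a path from `p` to `q` which is
isometric on `[0, dist p q]`. -/
def IsGeodesicSegment {X : Type*} [MetricSpace X] (S : Set X) (p q : X) : Prop :=
  ∃ c : ℝ → X, c 0 = p ∧ c (dist p q) = q ∧
    (∀ s ∈ Icc 0 (dist p q), ∀ t ∈ Icc 0 (dist p q), dist (c s) (c t) = |s - t|) ∧
    S = c '' Icc 0 (dist p q)

/-- A geodesic metric space: any two points are joined by a geodesic segment. -/
def IsGeodesicSpace (X : Type*) [MetricSpace X] : Prop :=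
  ∀ p q : X, ∃ S : Set X, IsGeodesicSegment S p q

/-- A triangle `Δ(p, q, r)`: three vertices together with a choice of three geodesic sides. -/
structure GeodesicTriangle (X : Type*) [MetricSpace X] where
  p : X
  q : X
  r : X
  pq : Set X
  qr : Set X
  rp : Set X
  isGeodesicSegment_pq : IsGeodesicSegment pq p q
  isGeodesicSegment_qr : IsGeodesicSegment qr q r
  isGeodesicSegment_rp : IsGeodesicSegment rp r p

/-- `T` is a comparison triangle in `M` for `Δ`: corresponding sides have equal lengths. -/
def IsComparisonTriangle {X M : Type*} [MetricSpace X] [MetricSpace M]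
    (Δ : GeodesicTriangle X) (T : GeodesicTriangle M) : Prop :=
  dist T.p T.q = dist Δ.p Δ.q ∧ dist T.q T.r = dist Δ.q Δ.r ∧ dist T.r T.p = dist Δ.r Δ.p

/-- `x'` is a comparison point in `T` for the point `x` of `Δ`: they lie on corresponding sides,
at the same distance from the corresponding endpoint. -/
def IsComparisonPoint {X M : Type*} [MetricSpace X] [MetricSpace M]
    (Δ : GeodesicTriangle X) (T : GeodesicTriangle M) (x : X) (x' : M) : Prop :=
  (x ∈ Δ.pq ∧ x' ∈ T.pq ∧ dist T.p x' = dist Δ.p x) ∨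
  (x ∈ Δ.qr ∧ x' ∈ T.qr ∧ dist T.q x' = dist Δ.q x) ∨
  (x ∈ Δ.rp ∧ x' ∈ T.rp ∧ dist T.r x' = dist Δ.r x)

/-- The comparison inequality for the triangle `Δ` with respect to the model space `M`.  In the
model planes used below a comparison triangle always exists and is unique up to isometry, so that
it does not matter which one is taken. -/
def SatisfiesComparison (M : Type*) [MetricSpace M] {X : Type*} [MetricSpace X]
    (Δ : GeodesicTriangle X) : Prop :=
  ∃ T : GeodesicTriangle M, IsComparisonTriangle Δ T ∧
    ∀ (x y : X) (x' y' : M), IsComparisonPoint Δ T x x' → IsComparisonPoint Δ T y y' →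
      dist x y ≤ dist x' y'

/-- A CAT(0) space: a geodesic space whose triangles are at least as thin as those of the
Euclidean plane. -/
def IsCATZero (X : Type*) [MetricSpace X] : Prop :=
  IsGeodesicSpace X ∧ ∀ Δ : GeodesicTriangle X, SatisfiesComparison (EuclideanSpace ℝ (Fin 2)) Δ

/-- A CAT(-1) space: a geodesic space whose triangles are at least as thin as those of the
hyperbolic plane (the upper half-plane with its hyperbolic distance, of curvature `-1`). -/
def IsCATNegOne (X : Type*) [MetricSpace X] : Prop :=
  IsGeodesicSpace X ∧ ∀ Δ : GeodesicTriangle X, SatisfiesComparison UpperHalfPlane Δ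

/-- The nearest-point projection of `x` onto `Y`, as the set of all points of `Y` that realize
the distance from `x` to `Y`. -/
def nearestPoints {X : Type*} [MetricSpace X] (Y : Set X) (x : X) : Set X :=
  {p | p ∈ Y ∧ dist x p = Metric.infDist x Y}

/-- `Y` is `B`-contracting: the nearest-point projection onto `Y` of any ball disjoint from `Y`
has diameter at most `B`. -/
def IsContractingWith {X : Type*} [MetricSpace X] (Y : Set X) (B : ℝ) : Prop :=
  0 ≤ B ∧ ∀ (x : X) (r : ℝ), Disjoint (Metric.ball x r) Y →
    ∀ p ∈ ⋃ y ∈ Metric.ball x r, nearestPoints Y y,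
      ∀ q ∈ ⋃ y ∈ Metric.ball x r, nearestPoints Y y, dist p q ≤ B

/-- `Y` is contracting: it is `B`-contracting for some `B`. -/
def IsContracting {X : Type*} [MetricSpace X] (Y : Set X) : Prop :=
  ∃ B : ℝ, IsContractingWith Y B

/-- The constant `η(ε) = 2π / (π - 4 arccos √(cosh ε / (cosh ε + 1)))`. -/
noncomputable def eta (ε : ℝ) : ℝ :=
  2 * Real.pi / (Real.pi - 4 * Real.arccos (Real.sqrt (Real.cosh ε / (Real.cosh ε + 1))))

end PartiallyCAT

/-! A right triangle inside a CAT(-1) ball has a definite angle deficit, and only boundedly many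
such deficits fit under one geodesic. Let `x` be the centre of the ball and `y` one of its points,
with feet `γ a` and `γ b`, say `a ≤ b`. The projection is 1-Lipschitz (`IsFoot.abs_sub_le`), so [x,
y] passes over every `t n` between `a` and `b`. Since d(x, y) is less than the distance from `x` to
the line, it does so at height more than `l` as long as the parameter distance left to `b` is at
least `l`.

Consecutive fibres over the `t n`, the line and [x, y] bound a strip. Cut off the right triangle
with both legs `l` at the corner lying in a CAT(-1) ball: its acute angles are at most α =
`baseAngle δ` < π/4. The CAT(0) angle sum on the rest shows that the two upper angles of the strip
add up to at most π/2 + 2α (`IsFoot.strip_angle_le`). The two angles on either side of a fibre add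
up to at least π, so the angle between the fibre and the part of [x, y] already travelled drops by
at least π/2 - 2α from one fibre to the next (`IsFoot.angle_descent`). It starts at most at π and
stays nonnegative, which allows at most η = π / (π/2 - 2α) steps. The gap bound `L` turns this count
into a bound on b - a (`IsFoot.sub_le`).

All comparison arguments go through Stewart's relation, Euclidean or hyperbolic, which becomes an
inequality in the space. Alexandrov angles are infima of chord ratios. -/

namespace PartiallyCAT

/-! ### Comparison points in an arbitrary model space -/

section Model

variable {X M : Type*} [MetricSpace X] [MetricSpace M]

/-- In a geodesic segment every intermediate distance is realized. -/
lemma IsGeodesicSegment.exists_mem {S : Set X} {p q : X} (h : IsGeodesicSegment S p q) {s : ℝ}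
    (h0 : 0 ≤ s) (h1 : s ≤ dist p q) : ∃ m ∈ S, dist p m = s ∧ dist m q = dist p q - s := by
  obtain ⟨c, c0, c1, hc, rfl⟩ := h
  have hs : s ∈ Icc 0 (dist p q) := ⟨h0, h1⟩
  refine ⟨c s, mem_image_of_mem _ hs, ?_, ?_⟩
  · have := hc 0 ⟨le_rfl, dist_nonneg⟩ s hs
    rw [c0] at this
    rw [this, zero_sub, abs_neg, abs_of_nonneg h0]
  · have := hc s hs (dist p q) ⟨dist_nonneg, le_rfl⟩
    rw [c1] at this
    rw [this, abs_sub_comm, abs_of_nonneg (by linarith)]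

lemma IsGeodesicSegment.right_mem {S : Set X} {p q : X} (h : IsGeodesicSegment S p q) : q ∈ S := by
  obtain ⟨c, -, c1, -, rfl⟩ := h
  exact ⟨dist p q, ⟨dist_nonneg, le_rfl⟩, c1⟩

/-- The comparison inequality between a point of a side and the opposite vertex. -/
lemma SatisfiesComparison.exists_points {Δ : GeodesicTriangle X} (h : SatisfiesComparison M Δ)
    {m : X} (hm : m ∈ Δ.pq) (h1 : dist Δ.p m + dist m Δ.q = dist Δ.p Δ.q) :
    ∃ P Q W N : M, dist P Q = dist Δ.p Δ.q ∧ dist Q W = dist Δ.q Δ.r ∧ dist W P = dist Δ.r Δ.p ∧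
      dist P N = dist Δ.p m ∧ dist N Q = dist m Δ.q ∧ dist Δ.r m ≤ dist W N := by
  obtain ⟨T, ⟨e1, e2, e3⟩, hT⟩ := h
  obtain ⟨N, hN, n1, n2⟩ := T.isGeodesicSegment_pq.exists_mem (s := dist Δ.p m) dist_nonneg
    (by rw [e1]; linarith [dist_nonneg (x := m) (y := Δ.q)])
  refine ⟨T.p, T.q, T.r, N, e1, e2, e3, n1, by rw [n2, e1]; linarith, ?_⟩
  exact hT _ _ _ _ (Or.inr (Or.inl ⟨Δ.isGeodesicSegment_qr.right_mem,
    T.isGeodesicSegment_qr.right_mem, e2⟩)) (Or.inl ⟨hm, hN, n1⟩)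

end Model

/-! ### Stewart's relation in the two model planes -/

section Planes

/-- Stewart's theorem in an inner product space, including the degenerate cases. -/
lemma stewart_eq {E : Type*} [NormedAddCommGroup E] [InnerProductSpace ℝ E] {P Q N : E}
    (h : dist P N + dist N Q = dist P Q) (W : E) :
    dist P Q * dist W N ^ 2 = dist N Q * dist W P ^ 2 + dist P N * dist W Q ^ 2
      - dist P N * dist N Q * dist P Q := by
  obtain ⟨t, ⟨t0, t1⟩, rfl⟩ := dist_add_dist_eq_iff.1 h
  have e1 : dist P (AffineMap.lineMap P Q t) = t * dist P Q := by
    rw [dist_left_lineMap, Real.norm_of_nonneg t0]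
  have e2 : dist (AffineMap.lineMap P Q t) Q = (1 - t) * dist P Q := by
    rw [dist_lineMap_right, Real.norm_of_nonneg (by linarith)]
  have e3 : dist W (AffineMap.lineMap P Q t) ^ 2
      = (1 - t) * dist W P ^ 2 + t * dist W Q ^ 2 - t * (1 - t) * dist P Q ^ 2 := by
    have a1 : W - AffineMap.lineMap P Q t = (1 - t) • (W - P) + t • (W - Q) := by
      rw [AffineMap.lineMap_apply_module]; module
    have a2 : P - Q = (W - Q) - (W - P) := by abel
    simp only [dist_eq_norm, a1, a2]
    rw [norm_add_sq_real, norm_sub_sq_real (W - Q), norm_smul, norm_smul, inner_smul_left, inner_smul_right,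
      mul_pow, mul_pow, Real.norm_eq_abs, Real.norm_eq_abs, sq_abs, sq_abs,
      real_inner_comm (W - P) (W - Q)]
    simp only [conj_trivial]
    ring
  rw [e1, e2, e3]; ring

/-- In Lorentzian 3-space, a null vector orthogonal to a timelike unit vector vanishes. -/
lemma lorentz_null_eq_zero {a b c p q r : ℝ} (h0 : a ^ 2 = b ^ 2 + c ^ 2)
    (hp : p ^ 2 = 1 + q ^ 2 + r ^ 2) (h : a * p = b * q + c * r) : a = 0 ∧ b = 0 ∧ c = 0 := by
  have ha : a ^ 2 ≤ 0 := by
    have h1 : (a * p) ^ 2 ≤ (b ^ 2 + c ^ 2) * (q ^ 2 + r ^ 2) := by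
      rw [h]; nlinarith [sq_nonneg (b * r - c * q)]
    rw [← h0, mul_pow, hp] at h1
    nlinarith
  have ha' : a = 0 := by nlinarith
  subst ha'
  refine ⟨rfl, ?_, ?_⟩ <;> nlinarith [sq_nonneg b, sq_nonneg c]

/-- This is the passage to the hyperboloid model: the three fractions are Lorentzian coordinates,
and the right side is minus the Lorentz product. -/
lemma cosh_dist_upperHalfPlane (z w : UpperHalfPlane) :
    Real.cosh (dist z w) =
      ((1 + z.re ^ 2 + z.im ^ 2) / (2 * z.im)) * ((1 + w.re ^ 2 + w.im ^ 2) / (2 * w.im))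
      - ((z.re ^ 2 + z.im ^ 2 - 1) / (2 * z.im)) * ((w.re ^ 2 + w.im ^ 2 - 1) / (2 * w.im))
      - (z.re / z.im) * (w.re / w.im) := by
  rw [UpperHalfPlane.cosh_dist']
  have := z.im_pos.ne'
  have := w.im_pos.ne'
  field_simp
  ring

/-- The analogue of Stewart's theorem in the hyperbolic plane. -/
lemma upperHalfPlane_stewart_eq {P Q N : UpperHalfPlane}
    (h : dist P N + dist N Q = dist P Q) (W : UpperHalfPlane) :
    Real.sinh (dist P Q) * Real.cosh (dist W N) = Real.sinh (dist N Q) * Real.cosh (dist W P)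
      + Real.sinh (dist P N) * Real.cosh (dist W Q) := by
  -- The coordinate vectors lie on the unit hyperboloid.
  have key : ∀ z : UpperHalfPlane, ((1 + z.re ^ 2 + z.im ^ 2) / (2 * z.im)) ^ 2
      = 1 + ((z.re ^ 2 + z.im ^ 2 - 1) / (2 * z.im)) ^ 2 + (z.re / z.im) ^ 2 := by
    intro z
    have := z.im_pos.ne'
    field_simp
    ring
  have kP := key P
  have kQ := key Q
  have kN := key N
  have hPN := cosh_dist_upperHalfPlane P N
  have hNQ := cosh_dist_upperHalfPlane N Q
  have hPQ := cosh_dist_upperHalfPlane P Q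
  simp only [cosh_dist_upperHalfPlane W]
  rw [← h] at hPQ ⊢
  generalize dist P N = s at *
  generalize dist N Q = u at *
  generalize (1 + P.re ^ 2 + P.im ^ 2) / (2 * P.im) = p0 at *
  generalize (P.re ^ 2 + P.im ^ 2 - 1) / (2 * P.im) = p1 at *
  generalize P.re / P.im = p2 at *
  generalize (1 + Q.re ^ 2 + Q.im ^ 2) / (2 * Q.im) = q0 at *
  generalize (Q.re ^ 2 + Q.im ^ 2 - 1) / (2 * Q.im) = q1 at *
  generalize Q.re / Q.im = q2 at *
  generalize (1 + N.re ^ 2 + N.im ^ 2) / (2 * N.im) = n0 at *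
  generalize (N.re ^ 2 + N.im ^ 2 - 1) / (2 * N.im) = n1 at *
  generalize N.re / N.im = n2 at *
  have cs := Real.cosh_sq s
  have cu := Real.cosh_sq u
  rw [Real.cosh_add] at hPQ
  rw [Real.sinh_add]
  generalize Real.cosh s = C at *
  generalize Real.cosh u = D at *
  generalize Real.sinh s = S at *
  generalize Real.sinh u = U at *
  -- With `A` = sinh(s + u), the vector v = A N - U P - S Q should vanish. It is orthogonal to N, P
  -- and Q, hence null, and a null vector orthogonal to the timelike P is zero. Pairing v = 0 with W
  -- gives the claim.
  set A := S * D + C * U with hA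
  set v0 := A * n0 - U * p0 - S * q0 with hv0
  set v1 := A * n1 - U * p1 - S * q1 with hv1
  set v2 := A * n2 - U * p2 - S * q2 with hv2
  have oN : v0 * n0 = v1 * n1 + v2 * n2 := by
    have : v0 * n0 - v1 * n1 - v2 * n2 = A - U * C - S * D := by
      rw [hv0, hv1, hv2, hPN, hNQ]; linear_combination A * kN
    linarith
  have oP : v0 * p0 = v1 * p1 + v2 * p2 := by
    have : v0 * p0 - v1 * p1 - v2 * p2 = A * C - U - S * (C * D + S * U) := by
      rw [hv0, hv1, hv2, hPQ, hPN]; linear_combination -U * kP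
    have e : A * C - U - S * (C * D + S * U) = 0 := by
      rw [hA]; linear_combination U * cs
    linarith
  have oQ : v0 * q0 = v1 * q1 + v2 * q2 := by
    have : v0 * q0 - v1 * q1 - v2 * q2 = A * D - U * (C * D + S * U) - S := by
      rw [hv0, hv1, hv2, hPQ, hNQ]; linear_combination -S * kQ
    have e : A * D - U * (C * D + S * U) - S = 0 := by
      rw [hA]; linear_combination S * cu
    linarith
  have o : v0 ^ 2 = v1 ^ 2 + v2 ^ 2 := by
    have : v0 ^ 2 - v1 ^ 2 - v2 ^ 2 = A * (v0 * n0 - v1 * n1 - v2 * n2)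
        - U * (v0 * p0 - v1 * p1 - v2 * p2) - S * (v0 * q0 - v1 * q1 - v2 * q2) := by
      simp only [hv0, hv1, hv2]; ring
    have e : v0 ^ 2 - v1 ^ 2 - v2 ^ 2 = 0 := by rw [this, oN, oP, oQ]; ring
    linarith
  obtain ⟨z0, z1, z2⟩ := lorentz_null_eq_zero o kP oP
  generalize (1 + W.re ^ 2 + W.im ^ 2) / (2 * W.im) = w0
  generalize (W.re ^ 2 + W.im ^ 2 - 1) / (2 * W.im) = w1
  generalize W.re / W.im = w2
  linear_combination w0 * z0 - w1 * z1 - w2 * z2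

end Planes

/-! ### Stewart and quadrilateral inequalities; uniqueness of geodesics -/

variable {X : Type*} [MetricSpace X]

lemma IsCATZero.exists_btw (hX : IsCATZero X) {p q : X} {s : ℝ} (h0 : 0 ≤ s) (h1 : s ≤ dist p q) :
    ∃ m, dist p m = s ∧ dist m q = dist p q - s := by
  obtain ⟨S, hS⟩ := hX.1 p q
  obtain ⟨m, -, hm⟩ := hS.exists_mem h0 h1
  exact ⟨m, hm⟩

lemma IsGeodesicSpace.exists_triangle (hX : IsGeodesicSpace X) {S : Set X} {p q : X}
    (hS : IsGeodesicSegment S p q) (w : X) :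
    ∃ Δ : GeodesicTriangle X, Δ.p = p ∧ Δ.q = q ∧ Δ.r = w ∧ Δ.pq = S := by
  obtain ⟨S1, h1⟩ := hX q w
  obtain ⟨S2, h2⟩ := hX w p
  exact ⟨⟨p, q, w, S, S1, S2, hS, h1, h2⟩, rfl, rfl, rfl, rfl⟩

lemma IsCATZero.stewart_of_mem (hX : IsCATZero X) {S : Set X} {p q m : X}
    (hS : IsGeodesicSegment S p q) (hm : m ∈ S)
    (h : dist p m + dist m q = dist p q) (w : X) :
    dist p q * dist w m ^ 2 ≤ dist m q * dist w p ^ 2 + dist p m * dist w q ^ 2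
      - dist p m * dist m q * dist p q := by
  obtain ⟨Δ, rfl, rfl, rfl, rfl⟩ := hX.1.exists_triangle hS w
  obtain ⟨P, Q, W, N, e1, e2, e3, e4, e5, e6⟩ := (hX.2 Δ).exists_points hm h
  have := stewart_eq (P := P) (Q := Q) (N := N) (by rw [e1, e4, e5, h]) W
  rw [e1, e3, e4, e5, dist_comm W Q, e2] at this
  rw [dist_comm Δ.r Δ.q, ← this]
  gcongr

/-- Stewart's inequality with `w` a second point at the same distances from `p` and `q` bounds the
squared gap by zero. The comparison needs a point of a chosen segment, so `m` and `m'` are both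
compared with one such point. -/
lemma IsCATZero.unique (hX : IsCATZero X) {p q m m' : X}
    (h : dist p m + dist m q = dist p q) (h' : dist p m' + dist m' q = dist p q)
    (e : dist p m = dist p m') : m = m' := by
  obtain ⟨S, hS⟩ := hX.1 p q
  have aux : ∀ n, dist p n + dist n q = dist p q → ∀ n' ∈ S, dist p n' = dist p n →
      dist n' q = dist p q - dist p n → n = n' := by
    intro n hn n' hn' a1 a2
    have := hX.stewart_of_mem hS hn' (by rw [a1, a2]; ring) n
    rw [a1, a2, dist_comm n p, show dist n q = dist p q - dist p n by linarith] at this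
    have h2 : dist p q * dist n n' ^ 2 ≤ 0 := by nlinarith
    rcases eq_or_lt_of_le (dist_nonneg (x := p) (y := q)) with h0 | h0
    · have b1 : dist p n = 0 := by
        linarith [dist_nonneg (x := p) (y := n), dist_nonneg (x := n) (y := q)]
      rw [← dist_eq_zero.1 (a1.trans b1), ← dist_eq_zero.1 b1]
    · have : dist n n' ^ 2 ≤ 0 := by
        by_contra! hlt
        linarith [mul_pos h0 hlt]
      exact dist_eq_zero.1 (by nlinarith [dist_nonneg (x := n) (y := n')])
  obtain ⟨n, hn, a1, a2⟩ := hS.exists_mem (s := dist p m) dist_nonneg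
    (by linarith [dist_nonneg (x := m) (y := q)])
  rw [aux m h n hn a1 a2, aux m' h' n hn (a1.trans e) (by rw [a2, e])]

/-- Stewart's inequality in a CAT(0) space. -/
lemma IsCATZero.stewart (hX : IsCATZero X) {p q m : X}
    (h : dist p m + dist m q = dist p q) (w : X) :
    dist p q * dist w m ^ 2 ≤ dist m q * dist w p ^ 2 + dist p m * dist w q ^ 2
      - dist p m * dist m q * dist p q := by
  obtain ⟨S, hS⟩ := hX.1 p q
  obtain ⟨n, hn, a1, a2⟩ := hS.exists_mem (s := dist p m) dist_nonneg
    (by linarith [dist_nonneg (x := m) (y := q)])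
  obtain rfl : m = n := hX.unique h (by rw [a1, a2]; ring) a1.symm
  exact hX.stewart_of_mem hS hn h w

/-- The hyperbolic Stewart inequality, for points of a CAT(-1) ball of a CAT(0) space. -/
lemma IsCATZero.cosh_stewart (hX : IsCATZero X) {o : X} {ε : ℝ}
    (hb : IsCATNegOne (Metric.ball o ε)) {p q m w : X} (hp : p ∈ Metric.ball o ε)
    (hq : q ∈ Metric.ball o ε) (hw : w ∈ Metric.ball o ε)
    (h : dist p m + dist m q = dist p q) :
    Real.sinh (dist p q) * Real.cosh (dist w m) ≤ Real.sinh (dist m q) * Real.cosh (dist w p)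
      + Real.sinh (dist p m) * Real.cosh (dist w q) := by
  obtain ⟨S, hS⟩ := hb.1 ⟨p, hp⟩ ⟨q, hq⟩
  obtain ⟨n, hn, a1, a2⟩ := hS.exists_mem (s := dist p m) dist_nonneg
    (by rw [Subtype.dist_eq]; linarith [dist_nonneg (x := m) (y := q)])
  obtain ⟨n, hn'⟩ := n
  simp only [Subtype.dist_eq] at a1 a2
  -- The geodesic of the ball is also one of `X`, so uniqueness puts `m` in the ball; no separate
  -- convexity argument is needed.
  obtain rfl : m = n := hX.unique h (by rw [a1, a2]; ring) a1.symm
  obtain ⟨Δ, e1, e2, e3, rfl⟩ := hb.1.exists_triangle hS ⟨w, hw⟩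
  obtain ⟨P, Q, W, N, f1, f2, f3, f4, f5, f6⟩ := (hb.2 Δ).exists_points hn
    (by rw [e1, e2]; exact h)
  rw [e1, e2] at f1
  rw [e2, e3] at f2
  rw [e3, e1] at f3
  rw [e1] at f4
  rw [e2] at f5
  rw [e3] at f6
  simp only [Subtype.dist_eq] at f1 f2 f3 f4 f5 f6
  have := upperHalfPlane_stewart_eq (P := P) (Q := Q) (N := N) (by rw [f1, f4, f5, h]) W
  rw [f1, f3, f4, f5, dist_comm W Q, f2] at this
  rw [dist_comm w q, ← this]
  refine mul_le_mul_of_nonneg_left ?_ (Real.sinh_nonneg_iff.2 dist_nonneg)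
  rw [Real.cosh_le_cosh, abs_of_nonneg dist_nonneg, abs_of_nonneg dist_nonneg]
  exact f6

/-- The quadrilateral inequality. -/
lemma IsCATZero.quadrilateral (hX : IsCATZero X) (a b c d : X) :
    dist a c ^ 2 + dist b d ^ 2 ≤ dist a b ^ 2 + dist c d ^ 2 + 2 * dist b c * dist a d := by
  rcases eq_or_ne a d with rfl | had
  · simp [dist_comm]; linarith
  rcases eq_or_ne b c with rfl | hbc
  · simp
  have u0 := dist_pos.2 had
  have v0 := dist_pos.2 hbc
  set u := dist a d with hu
  set v := dist b c with hv
  have hle : u / (u + v) * dist a c ≤ dist a c :=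
    mul_le_of_le_one_left dist_nonneg (by rw [div_le_one (by positivity)]; linarith)
  -- `m` divides the diagonal in the ratio u : v of the sides at its two ends. With these weights
  -- the Stewart bounds for `b` and `d` combine with (x + y)² through the square (u x - v y)².
  obtain ⟨m, m1, m2⟩ := hX.exists_btw (p := a) (q := c) (s := u / (u + v) * dist a c)
    (by positivity) hle
  have m2' : dist m c = v / (u + v) * dist a c := by rw [m2]; field_simp; ring
  rcases eq_or_ne a c with rfl | hac
  · have h1 := dist_triangle b a d
    rw [dist_comm b a] at hv h1
    rw [dist_self, dist_comm a b]
    rw [← hv, ← hu] at h1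
    have := dist_nonneg (x := b) (y := d)
    rw [dist_comm b a, ← hv, ← hu]
    nlinarith
  have s0 := dist_pos.2 hac
  have hb := hX.stewart (p := a) (q := c) (m := m) (by rw [m1, m2]; ring) b
  have hd := hX.stewart (p := a) (q := c) (m := m) (by rw [m1, m2]; ring) d
  rw [m1, m2'] at hb hd
  rw [dist_comm b a, ← hv] at hb
  rw [dist_comm d a, ← hu, dist_comm d c] at hd
  have tri := dist_triangle b m d
  rw [dist_comm m d] at tri
  generalize dist b m = x at *
  generalize dist d m = y at *
  generalize dist a c = s at *
  have hx : (u + v) ^ 2 * x ^ 2 ≤ (u + v) * (v * dist a b ^ 2 + u * v ^ 2) - u * v * s ^ 2 := by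
    have : s * ((u + v) ^ 2 * x ^ 2)
        ≤ s * ((u + v) * (v * dist a b ^ 2 + u * v ^ 2) - u * v * s ^ 2) := by
      calc _ = (u + v) ^ 2 * (s * x ^ 2) := by ring
        _ ≤ (u + v) ^ 2 * _ := mul_le_mul_of_nonneg_left hb (by positivity)
        _ = _ := by field_simp
    exact le_of_mul_le_mul_left this s0
  have hy : (u + v) ^ 2 * y ^ 2 ≤ (u + v) * (v * u ^ 2 + u * dist c d ^ 2) - u * v * s ^ 2 := by
    have : s * ((u + v) ^ 2 * y ^ 2)
        ≤ s * ((u + v) * (v * u ^ 2 + u * dist c d ^ 2) - u * v * s ^ 2) := by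
      calc _ = (u + v) ^ 2 * (s * y ^ 2) := by ring
        _ ≤ (u + v) ^ 2 * _ := mul_le_mul_of_nonneg_left hd (by positivity)
        _ = _ := by field_simp
    exact le_of_mul_le_mul_left this s0
  have hxy : u * v * dist b d ^ 2 ≤ (u + v) * (u * x ^ 2 + v * y ^ 2) := by
    have h2 : dist b d ^ 2 ≤ (x + y) ^ 2 := pow_le_pow_left₀ dist_nonneg tri 2
    calc u * v * dist b d ^ 2 ≤ u * v * (x + y) ^ 2 := by gcongr
      _ ≤ _ := by nlinarith [sq_nonneg (u * x - v * y)]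
  have hfin : (u + v) * (u * v * dist b d ^ 2)
      ≤ (u + v) * (u * v * (dist a b ^ 2 + dist c d ^ 2 + 2 * v * u - s ^ 2)) := by
    calc _ ≤ (u + v) * ((u + v) * (u * x ^ 2 + v * y ^ 2)) := by gcongr
      _ = u * ((u + v) ^ 2 * x ^ 2) + v * ((u + v) ^ 2 * y ^ 2) := by ring
      _ ≤ u * ((u + v) * (v * dist a b ^ 2 + u * v ^ 2) - u * v * s ^ 2)
          + v * ((u + v) * (v * u ^ 2 + u * dist c d ^ 2) - u * v * s ^ 2) := by gcongr
      _ = _ := by ring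
  have := le_of_mul_le_mul_left (le_of_mul_le_mul_left hfin (by positivity)) (by positivity)
  linarith

lemma IsCATZero.exists_ne (hX : IsCATZero X) {p x : X} {s : ℝ} (h0 : 0 < s) (h1 : s ≤ dist p x) :
    ∃ u, u ≠ p ∧ dist p u = s ∧ dist p u + dist u x = dist p x := by
  obtain ⟨u, e1, e2⟩ := hX.exists_btw h0.le h1
  refine ⟨u, ?_, e1, by rw [e1, e2]; ring⟩
  rintro rfl
  rw [dist_self] at e1
  exact h0.ne e1

/-- Points of a segment are ordered by their distance to an endpoint. -/
lemma IsCATZero.btw_of_le (hX : IsCATZero X) {p x u v : X} (hu : dist p u + dist u x = dist p x)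
    (hv : dist p v + dist v x = dist p x) (h : dist p u ≤ dist p v) :
    dist p u + dist u v = dist p v := by
  obtain ⟨n, e1, e2⟩ := hX.exists_btw (p := p) (q := v) dist_nonneg h
  have hn : dist p n + dist n x = dist p x :=
    le_antisymm (by linarith [dist_triangle n v x]) (dist_triangle p n x)
  rw [hX.unique hu hn e1.symm, e1, e2]
  ring

lemma btw_trans {p u v x : X} (h : dist p u + dist u v = dist p v)
    (h' : dist p v + dist v x = dist p x) : dist p u + dist u x = dist p x :=
  le_antisymm (by linarith [dist_triangle u v x]) (dist_triangle p u x)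

lemma btw_trans_right {p u v x : X} (h : dist p u + dist u v = dist p v)
    (h' : dist p v + dist v x = dist p x) : dist u v + dist v x = dist u x :=
  le_antisymm (by linarith [dist_triangle p u x]) (dist_triangle u v x)

lemma btw_comm {p u x : X} (h : dist p u + dist u x = dist p x) :
    dist x u + dist u p = dist x p := by
  rw [dist_comm x u, dist_comm u p, dist_comm x p, ← h, add_comm]

/-- Comparison for points on two sides issuing from the same vertex. -/
lemma IsCATZero.thin (hX : IsCATZero X) {p x y u v : X} (hu : dist p u + dist u x = dist p x)
    (hv : dist p v + dist v y = dist p y) :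
    dist p x * dist p y * dist u v ^ 2 ≤ dist p x * dist p y * (dist p u ^ 2 + dist p v ^ 2)
      - dist p u * dist p v * (dist p x ^ 2 + dist p y ^ 2 - dist x y ^ 2) := by
  have h1 := hX.stewart hu v
  have h2 := hX.stewart hv x
  rw [dist_comm v u, dist_comm v p, dist_comm v x] at h1
  rw [dist_comm x p] at h2
  have e1 : dist u x = dist p x - dist p u := by linarith
  have e2 : dist v y = dist p y - dist p v := by linarith
  rw [e1] at h1
  rw [e2] at h2
  have h3 := mul_le_mul_of_nonneg_left h1 (dist_nonneg (x := p) (y := y))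
  have h4 := mul_le_mul_of_nonneg_left h2 (dist_nonneg (x := p) (y := u))
  linarith

/-! ### Alexandrov angles -/

/-- The ratios `d(u, v) / 2s` for the points `u`, `v` at the same distance `s > 0` from `p` on
the segments `[p, x]` and `[p, y]`. -/
def chordRatios (p x y : X) : Set ℝ :=
  {c | ∃ u v, u ≠ p ∧ dist p u = dist p v ∧ dist p u + dist u x = dist p x ∧
    dist p v + dist v y = dist p y ∧ c = dist u v / (2 * dist p u)}

/-- The sine of half the Alexandrov angle at `p` between `[p, x]` and `[p, y]`, in a CAT(0)
space. -/
noncomputable def halfSin (p x y : X) : ℝ := sInf (chordRatios p x y)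

/-- The Alexandrov angle at `p` between `[p, x]` and `[p, y]`, in a CAT(0) space. -/
noncomputable def angle (p x y : X) : ℝ := 2 * Real.arcsin (halfSin p x y)

lemma nonneg_of_mem_chordRatios {p x y : X} {c : ℝ} (h : c ∈ chordRatios p x y) : 0 ≤ c := by
  obtain ⟨u, v, -, -, -, -, rfl⟩ := h
  positivity

lemma halfSin_nonneg (p x y : X) : 0 ≤ halfSin p x y :=
  Real.sInf_nonneg fun _ h => nonneg_of_mem_chordRatios h

lemma halfSin_le {p x y u v : X} (hup : u ≠ p) (huv : dist p u = dist p v)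
    (hu : dist p u + dist u x = dist p x) (hv : dist p v + dist v y = dist p y) {c : ℝ}
    (h : dist u v ≤ 2 * dist p u * c) : halfSin p x y ≤ c := by
  have hpos : 0 < dist p u := dist_pos.2 hup.symm
  refine (csInf_le ⟨0, fun _ h => nonneg_of_mem_chordRatios h⟩
    ⟨u, v, hup, huv, hu, hv, rfl⟩).trans ?_
  rw [div_le_iff₀ (by positivity)]
  linarith

lemma IsCATZero.chordRatios_nonempty (hX : IsCATZero X) {p x y : X} (hx : x ≠ p) (hy : y ≠ p) :
    (chordRatios p x y).Nonempty := by
  have hs : 0 < min (dist p x) (dist p y) := lt_min (dist_pos.2 hx.symm) (dist_pos.2 hy.symm)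
  obtain ⟨u, u1, u2, u3⟩ := hX.exists_ne hs (min_le_left _ _)
  obtain ⟨v, -, v2, v3⟩ := hX.exists_ne hs (min_le_right _ _)
  exact ⟨_, u, v, u1, u2.trans v2.symm, u3, v3, rfl⟩

lemma IsCATZero.le_halfSin (hX : IsCATZero X) {p x y : X} (hx : x ≠ p) (hy : y ≠ p) {c : ℝ}
    (h : ∀ u v, u ≠ p → dist p u = dist p v → dist p u + dist u x = dist p x →
      dist p v + dist v y = dist p y → 2 * dist p u * c ≤ dist u v) : c ≤ halfSin p x y := by
  refine le_csInf (hX.chordRatios_nonempty hx hy) ?_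
  rintro _ ⟨u, v, h1, h2, h3, h4, rfl⟩
  have hpos : 0 < dist p u := dist_pos.2 h1.symm
  rw [le_div_iff₀ (by positivity)]
  linarith [h u v h1 h2 h3 h4]

lemma angle_nonneg (p x y : X) : 0 ≤ angle p x y :=
  mul_nonneg two_pos.le (Real.arcsin_nonneg.2 (halfSin_nonneg p x y))

lemma angle_le_pi (p x y : X) : angle p x y ≤ Real.pi := by
  have := Real.arcsin_le_pi_div_two (halfSin p x y)
  rw [angle]
  linarith

lemma angle_comm (p x y : X) : angle p x y = angle p y x := by
  have : ∀ x y : X, chordRatios p x y ⊆ chordRatios p y x := by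
    rintro x y _ ⟨u, v, h1, h2, h3, h4, rfl⟩
    refine ⟨v, u, ?_, h2.symm, h4, h3, by rw [dist_comm, h2]⟩
    rintro rfl
    rw [dist_self] at h2
    exact h1 (dist_eq_zero.1 h2).symm
  rw [angle, angle, halfSin, halfSin, (this x y).antisymm (this y x)]

/-- Shortening a side does not decrease the angle. -/
lemma IsCATZero.angle_le_of_btw (hX : IsCATZero X) {p x y z : X} (hx : x ≠ p) (hy : y ≠ p)
    (h : dist p x + dist x z = dist p z) : angle p z y ≤ angle p x y := by
  refine mul_le_mul_of_nonneg_left (Real.monotone_arcsin (csInf_le_csInf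
    ⟨0, fun _ h => nonneg_of_mem_chordRatios h⟩ (hX.chordRatios_nonempty hx hy) ?_)) two_pos.le
  rintro _ ⟨u, v, h1, h2, h3, h4, rfl⟩
  exact ⟨u, v, h1, h2, btw_trans h3 h, h4, rfl⟩

lemma angle_le_of_halfSin_le {p x y : X} {t : ℝ} (h0 : 0 ≤ t) (h1 : t ≤ Real.pi)
    (h : halfSin p x y ≤ Real.sin (t / 2)) : angle p x y ≤ t := by
  have := Real.monotone_arcsin h
  rw [Real.arcsin_sin (by linarith) (by linarith)] at this
  rw [angle]
  linarith

lemma halfSin_lt_of_angle_lt {p x y : X} {t : ℝ} (h1 : t ≤ Real.pi)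
    (h : angle p x y < t) : halfSin p x y < Real.sin (t / 2) := by
  have h0 := (angle_nonneg p x y).trans_lt h
  rw [angle] at h
  by_contra! hle
  have := Real.monotone_arcsin hle
  rw [Real.arcsin_sin (by linarith) (by linarith)] at this
  linarith

/-- Chords close to the vertex have ratio close to `halfSin`. -/
lemma IsCATZero.exists_chord_lt (hX : IsCATZero X) {p x y : X} (hx : x ≠ p) (hy : y ≠ p) {c : ℝ}
    (h : halfSin p x y < c) : ∃ s > 0, s ≤ dist p x ∧ s ≤ dist p y ∧ ∀ u v,
      dist p u ≤ s → dist p u = dist p v → dist p u + dist u x = dist p x →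
      dist p v + dist v y = dist p y → dist u v ≤ 2 * dist p u * c := by
  obtain ⟨_, ⟨a, b, h1, h2, h3, h4, rfl⟩, hlt⟩ :=
    exists_lt_of_csInf_lt (hX.chordRatios_nonempty hx hy) h
  have hpos : 0 < dist p a := dist_pos.2 h1.symm
  have hc : 0 ≤ c := (halfSin_nonneg p x y).trans h.le
  refine ⟨dist p a, hpos, by linarith [dist_nonneg (x := a) (y := x)],
    by linarith [dist_nonneg (x := b) (y := y)], fun u v e1 e2 e3 e4 => ?_⟩
  -- Chord ratios do not increase towards the vertex, so one good chord controls all shorter ones.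
  have k := hX.thin (hX.btw_of_le e3 h3 e1) (hX.btw_of_le e4 h4 (by rw [← e2, ← h2]; exact e1))
  rw [← e2, ← h2] at k
  rw [div_lt_iff₀ (by positivity)] at hlt
  have k2 : dist p a ^ 2 * dist u v ^ 2 ≤ dist p a ^ 2 * (2 * dist p u * c) ^ 2 := by
    calc dist p a ^ 2 * dist u v ^ 2 ≤ dist p u ^ 2 * dist a b ^ 2 := by linarith
      _ ≤ dist p u ^ 2 * (c * (2 * dist p a)) ^ 2 := by gcongr
      _ = _ := by ring
  have k3 := le_of_mul_le_mul_left k2 (by positivity)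
  exact (le_abs_self _).trans (abs_le_of_sq_le_sq k3 (by positivity))

/-- In an isosceles Euclidean triangle with legs `s` and apex angle `2 (h + k)`, the length of the
part of the base cut off by the line at angle `2 h`. -/
lemma isosceles_identity {s h k : ℝ} (hψ : Real.cos (h - k) ≠ 0) :
    s ^ 2 + (s * Real.cos (h + k) / Real.cos (h - k)) ^ 2
      - 2 * s * (s * Real.cos (h + k) / Real.cos (h - k)) * Real.cos (2 * h)
      = (s * Real.sin (2 * h) / Real.cos (h - k)) ^ 2 := by
  have e : 2 * h = (h + k) + (h - k) := by ring
  rw [e, Real.cos_add (h + k), Real.sin_add (h + k)]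
  have a1 := Real.sin_sq_add_cos_sq (h + k)
  have a2 := Real.sin_sq_add_cos_sq (h - k)
  generalize Real.cos (h + k) = C at *
  generalize Real.cos (h - k) = D at *
  generalize Real.sin (h + k) = S at *
  generalize Real.sin (h - k) = U at *
  field_simp
  linear_combination -s ^ 2 * D ^ 2 * a1 - s ^ 2 * C ^ 2 * a2

/-- The length of the part of a base cut off by an inner line, bounded by the Euclidean value. -/
lemma IsCATZero.cut_le (hX : IsCATZero X) {p u v v' : X} {s h k : ℝ} (hs : 0 < s)
    (hu : dist p u = s) (hv : dist p v = s) (hv' : dist p v' + dist v' v = dist p v)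
    (hψ : 0 < Real.cos (h - k)) (h2 : 0 ≤ Real.sin (2 * h))
    (e : dist p v' = s * Real.cos (h + k) / Real.cos (h - k))
    (hc : dist u v ≤ 2 * s * Real.sin h) :
    dist u v' ≤ s * Real.sin (2 * h) / Real.cos (h - k) := by
  have k1 := hX.thin (p := p) (x := u) (y := v) (u := u) (v := v') (by simp) hv'
  have k2 := isosceles_identity (s := s) hψ.ne'
  rw [← e] at k2
  have t0 : 0 ≤ dist p v' := dist_nonneg
  rw [hu, hv] at k1
  have k3 : dist u v ^ 2 ≤ 2 * s ^ 2 * (1 - Real.cos (2 * h)) := by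
    calc dist u v ^ 2 ≤ (2 * s * Real.sin h) ^ 2 := pow_le_pow_left₀ dist_nonneg hc 2
      _ = _ := by rw [Real.cos_two_mul, Real.cos_sq']; ring
  have k4 : s * s * dist u v' ^ 2 ≤ s * s * (s * Real.sin (2 * h) / Real.cos (h - k)) ^ 2 := by
    rw [← k2]
    have := mul_le_mul_of_nonneg_left k3 (mul_nonneg hs.le t0)
    linarith
  exact (le_abs_self _).trans (abs_le_of_sq_le_sq (le_of_mul_le_mul_left k4 (by positivity)) (by positivity))

/-- The triangle inequality for angles. -/
lemma IsCATZero.angle_triangle (hX : IsCATZero X) {p x y z : X} (hx : x ≠ p) (hy : y ≠ p)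
    (hz : z ≠ p) : angle p x z ≤ angle p x y + angle p y z := by
  by_contra! hlt
  have hpi := angle_le_pi p x z
  -- A third of the gap: `2 * h` and `2 * k` each exceed their angle by `e`, and their sum still
  -- stays below the angle from `x` to `z`.
  set e := (angle p x z - angle p x y - angle p y z) / 3 with he
  have e0 : 0 < e := by rw [he]; linarith
  have a0 := angle_nonneg p x y
  have b0 := angle_nonneg p y z
  obtain ⟨h, hh⟩ : ∃ h, 2 * h = angle p x y + e := ⟨(angle p x y + e) / 2, by ring⟩
  obtain ⟨k, hk⟩ : ∃ k, 2 * k = angle p y z + e := ⟨(angle p y z + e) / 2, by ring⟩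
  have hsum : 2 * h + 2 * k < angle p x z := by linarith
  have h1 := halfSin_lt_of_angle_lt (p := p) (x := x) (y := y) (t := 2 * h) (by linarith)
    (by linarith)
  have h2 := halfSin_lt_of_angle_lt (p := p) (x := y) (y := z) (t := 2 * k) (by linarith)
    (by linarith)
  obtain ⟨s1, s1pos, s1x, s1y, H1⟩ := hX.exists_chord_lt hx hy h1
  obtain ⟨s2, s2pos, s2y, s2z, H2⟩ := hX.exists_chord_lt hy hz h2
  rw [mul_div_cancel_left₀ h two_ne_zero] at H1
  rw [mul_div_cancel_left₀ k two_ne_zero] at H2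
  set s := min s1 s2
  have hs : 0 < s := lt_min s1pos s2pos
  have hs1 : s ≤ s1 := min_le_left _ _
  have hs2 : s ≤ s2 := min_le_right _ _
  obtain ⟨u, u1, u2, u3⟩ := hX.exists_ne hs (hs1.trans s1x)
  obtain ⟨v, v1, v2, v3⟩ := hX.exists_ne hs (hs1.trans s1y)
  obtain ⟨w, w1, w2, w3⟩ := hX.exists_ne hs (hs2.trans s2z)
  have hψ : 0 < Real.cos (h - k) := Real.cos_pos_of_mem_Ioo ⟨by linarith, by linarith⟩
  have hφ : 0 < Real.cos (h + k) := Real.cos_pos_of_mem_Ioo ⟨by linarith, by linarith⟩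
  have hle : Real.cos (h + k) ≤ Real.cos (h - k) := by
    rw [Real.cos_add, Real.cos_sub]
    have := mul_nonneg (Real.sin_nonneg_of_nonneg_of_le_pi (x := h) (by linarith) (by linarith))
      (Real.sin_nonneg_of_nonneg_of_le_pi (x := k) (by linarith) (by linarith))
    linarith
  -- `v'` is placed where, in the Euclidean isosceles triangle of apex angle 2h + 2k, the inner ray
  -- meets the base. The path from `u` to `w` through it is then at most the Euclidean base.
  obtain ⟨v', e1, e2⟩ := hX.exists_btw (p := p) (q := v)
    (s := s * Real.cos (h + k) / Real.cos (h - k)) (by positivity) (by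
      rw [v2, div_le_iff₀ hψ]; gcongr)
  have hv' : dist p v' + dist v' v = dist p v := by rw [e1, e2]; ring
  have c1 := hX.cut_le hs u2 v2 hv' hψ
    (Real.sin_nonneg_of_nonneg_of_le_pi (by linarith) (by linarith)) e1
    (by rw [← u2]; exact H1 u v (u2.trans_le hs1) (u2.trans v2.symm) u3 v3)
  have hψ' : Real.cos (k - h) = Real.cos (h - k) := by rw [← Real.cos_neg]; congr 1; ring
  have c2 := hX.cut_le (h := k) (k := h) hs w2 v2 hv' (by rwa [hψ'])
    (Real.sin_nonneg_of_nonneg_of_le_pi (by linarith) (by linarith))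
    (by rw [hψ', add_comm k h, e1])
    (by rw [← v2, dist_comm]; exact H2 v w (v2.trans_le hs2) (v2.trans w2.symm) v3 w3)
  rw [hψ'] at c2
  have c3 : halfSin p x z ≤ Real.sin ((2 * h + 2 * k) / 2) := by
    refine halfSin_le u1 (u2.trans w2.symm) u3 w3 ?_
    have e3 : Real.sin (2 * h) + Real.sin (2 * k) = 2 * Real.sin (h + k) * Real.cos (h - k) := by
      have a1 : 2 * h = (h + k) + (h - k) := by ring
      have a2 : 2 * k = (h + k) - (h - k) := by ring
      rw [a1, a2, Real.sin_add (h + k), Real.sin_sub (h + k)]; ring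
    calc dist u w ≤ dist u v' + dist w v' := dist_triangle_right u w v'
      _ ≤ s * Real.sin (2 * h) / Real.cos (h - k) + s * Real.sin (2 * k) / Real.cos (h - k) :=
        add_le_add c1 c2
      _ = s * (Real.sin (2 * h) + Real.sin (2 * k)) / Real.cos (h - k) := by ring
      _ = 2 * s * Real.sin (h + k) := by rw [e3]; field_simp
      _ = _ := by rw [u2]; congr 2; ring
  have := angle_le_of_halfSin_le (t := 2 * h + 2 * k) (by linarith) (by linarith) c3
  linarith

/-- A straight angle. -/
lemma IsCATZero.angle_eq_pi (hX : IsCATZero X) {p x y : X} (hx : x ≠ p) (hy : y ≠ p)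
    (h : dist x p + dist p y = dist x y) : angle p x y = Real.pi := by
  have : 1 ≤ halfSin p x y := by
    refine hX.le_halfSin hx hy fun u v _ h2 h3 h4 => ?_
    have := dist_triangle4 x u v y
    rw [dist_comm x u] at this
    rw [dist_comm x p] at h
    linarith
  rw [angle, Real.arcsin_of_one_le this]
  ring

/-- This turns an upper bound for the angle on one side of a direction into a lower bound on the
other side. -/
lemma IsCATZero.pi_le_angle_add_angle (hX : IsCATZero X) {p x y w : X} (hx : x ≠ p) (hy : y ≠ p)
    (hw : w ≠ p) (h : dist x p + dist p y = dist x y) :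
    Real.pi ≤ angle p x w + angle p w y := by
  rw [← hX.angle_eq_pi hx hy h]
  exact hX.angle_triangle hx hw hy

/-- Angles are at most the Euclidean comparison angles. -/
lemma IsCATZero.angle_le_of_law_cos (hX : IsCATZero X) {p x y : X} (hx : x ≠ p) (hy : y ≠ p)
    {t : ℝ} (h0 : 0 ≤ t) (h1 : t ≤ Real.pi)
    (h : dist x y ^ 2 = dist p x ^ 2 + dist p y ^ 2 - 2 * dist p x * dist p y * Real.cos t) :
    angle p x y ≤ t := by
  refine angle_le_of_halfSin_le h0 h1 ?_
  have px : 0 < dist p x := dist_pos.2 hx.symm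
  have py : 0 < dist p y := dist_pos.2 hy.symm
  have hs : 0 < min (dist p x) (dist p y) := lt_min px py
  obtain ⟨u, u1, u2, u3⟩ := hX.exists_ne hs (min_le_left _ _)
  obtain ⟨v, -, v2, v3⟩ := hX.exists_ne hs (min_le_right _ _)
  refine halfSin_le u1 (u2.trans v2.symm) u3 v3 ?_
  have k := hX.thin u3 v3
  rw [h, v2, u2] at k
  rw [u2]
  generalize min (dist p x) (dist p y) = s at *
  have hsin := Real.sin_nonneg_of_nonneg_of_le_pi (x := t / 2) (by linarith) (by linarith)
  have hcos : Real.cos t = 1 - 2 * Real.sin (t / 2) ^ 2 := by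
    conv_lhs => rw [show t = 2 * (t / 2) by ring]
    rw [Real.cos_two_mul, Real.cos_sq']; ring
  rw [hcos] at k
  have : dist p x * dist p y * dist u v ^ 2
      ≤ dist p x * dist p y * (2 * s * Real.sin (t / 2)) ^ 2 := by linarith
  exact (le_abs_self _).trans (abs_le_of_sq_le_sq (le_of_mul_le_mul_left this (by positivity)) (by positivity))

/-- The angle sum of a triangle is at most `π`. -/
lemma IsCATZero.angle_sum_le (hX : IsCATZero X) {p q r : X} (hpq : p ≠ q) (hqr : q ≠ r)
    (hrp : r ≠ p) : angle p q r + angle q r p + angle r p q ≤ Real.pi := by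
  obtain ⟨S, hS⟩ := hX.1 p q
  obtain ⟨Δ, rfl, rfl, rfl, -⟩ := hX.1.exists_triangle hS r
  obtain ⟨T, ⟨e1, e2, e3⟩, -⟩ := hX.2 Δ
  have aux : ∀ (P Q R : EuclideanSpace ℝ (Fin 2)) (p q r : X), q ≠ p → r ≠ p →
      dist P Q = dist p q → dist Q R = dist q r → dist R P = dist r p →
      angle p q r ≤ EuclideanGeometry.angle Q P R := by
    intro P Q R p q r h1 h2 d1 d2 d3
    refine hX.angle_le_of_law_cos h1 h2 (EuclideanGeometry.angle_nonneg _ _ _)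
      (EuclideanGeometry.angle_le_pi _ _ _) ?_
    have := EuclideanGeometry.law_cos Q P R
    rw [dist_comm Q P, d1, d2, d3, dist_comm r p] at this
    linarith
  have k1 := aux T.p T.q T.r _ _ _ hpq.symm hrp e1 e2 e3
  have k2 := aux T.q T.r T.p _ _ _ hqr.symm hpq e2 e3 e1
  have k3 := aux T.r T.p T.q _ _ _ hrp.symm hqr e3 e1 e2
  have hne : T.q ≠ T.p := by
    rw [← dist_ne_zero, dist_comm, e1]
    exact dist_ne_zero.2 hpq
  have := EuclideanGeometry.angle_add_angle_add_angle_eq_pi T.r hne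
  rw [EuclideanGeometry.angle_comm T.p T.q T.r] at this
  rw [EuclideanGeometry.angle_comm T.q T.r T.p] at this
  rw [EuclideanGeometry.angle_comm T.r T.p T.q] at this
  linarith

/-! ### Nearest-point projection onto the line -/

/-- `γ u` is a nearest point of `z` on the line `γ`. -/
def IsFoot (γ : ℝ → X) (z : X) (u : ℝ) : Prop := ∀ v, dist z (γ u) ≤ dist z (γ v)

lemma dist_line {γ : ℝ → X} (hγ : Isometry γ) (u v : ℝ) :
    dist (γ u) (γ v) = |u - v| := by
  rw [hγ.dist_eq, Real.dist_eq]

/-- The distance to `z` tends to infinity along the line, so compactness in ℝ suffices and `X` need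
not be proper or complete. -/
lemma exists_isFoot {γ : ℝ → X} (hγ : Isometry γ) (z : X) : ∃ u, IsFoot γ z u := by
  refine Continuous.exists_forall_le (continuous_const.dist hγ.continuous) ?_
  refine Filter.tendsto_atTop_mono (f := fun v => ‖v‖ + -dist z (γ 0)) (fun v => ?_)
    (Filter.tendsto_atTop_add_const_right _ _ tendsto_norm_cocompact_atTop)
  have h1 := dist_triangle_left (γ v) (γ 0) z
  rw [dist_line hγ, sub_zero] at h1
  rw [Real.norm_eq_abs]
  linarith

lemma isFoot_self (γ : ℝ → X) (u : ℝ) : IsFoot γ (γ u) u := fun v => by simp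

lemma IsFoot.of_btw {γ : ℝ → X} {z w : X} {u : ℝ} (h : IsFoot γ z u)
    (hw : dist (γ u) w + dist w z = dist (γ u) z) : IsFoot γ w u := fun v => by
  have h1 := h v
  have h2 := dist_triangle_left z (γ v) w
  rw [dist_comm w (γ u)]
  rw [dist_comm z (γ u)] at h1
  linarith

/-- A first-variation argument: apply Stewart to a point at a small fraction `t` of the way to `γ
v`, which is no closer to `z` than the foot, and let `t` be small enough. -/
lemma IsFoot.sq_le (hX : IsCATZero X) {γ : ℝ → X} (hγ : Isometry γ) {z : X} {u : ℝ}
    (h : IsFoot γ z u) (v : ℝ) : dist z (γ u) ^ 2 + (u - v) ^ 2 ≤ dist z (γ v) ^ 2 := by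
  rcases eq_or_ne u v with rfl | hne
  · simp
  by_contra! hlt
  have hA : 0 < |u - v| := abs_pos.2 (sub_ne_zero.2 hne)
  rw [← sq_abs (u - v)] at hlt
  set A := |u - v| with hAdef
  set g := dist z (γ u) ^ 2 + A ^ 2 - dist z (γ v) ^ 2 with hg
  have g0 : 0 < g := by linarith
  obtain ⟨t, t0, t1, ht⟩ : ∃ t, 0 < t ∧ t ≤ 1 ∧ t * A ^ 2 < g := by
    refine ⟨g / (g + A ^ 2), by positivity, ?_, ?_⟩
    · rw [div_le_one (by positivity)]
      nlinarith
    · rw [div_mul_eq_mul_div, div_lt_iff₀ (by positivity)]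
      nlinarith
  have d1 : dist (γ u) (γ (u + t * (v - u))) = t * A := by
    rw [dist_line hγ, show u - (u + t * (v - u)) = t * (u - v) by ring, abs_mul,
      abs_of_pos t0]
  have d2 : dist (γ (u + t * (v - u))) (γ v) = (1 - t) * A := by
    rw [dist_line hγ, show u + t * (v - u) - v = (1 - t) * (u - v) by ring, abs_mul,
      abs_of_nonneg (by linarith)]
  have d3 : dist (γ u) (γ v) = A := dist_line hγ u v
  have st := hX.stewart (p := γ u) (q := γ v) (m := γ (u + t * (v - u)))
    (by rw [d1, d2, d3]; ring) z
  rw [d1, d2, d3] at st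
  have hm := pow_le_pow_left₀ dist_nonneg (h (u + t * (v - u))) 2
  have k := (mul_le_mul_of_nonneg_left hm hA.le).trans st
  have k2 : A * t * (g - t * A ^ 2) ≤ 0 := by rw [hg]; linarith
  have := mul_pos (mul_pos hA t0) (sub_pos.2 ht)
  linarith

/-- The projection onto a line is 1-Lipschitz. -/
lemma IsFoot.abs_sub_le (hX : IsCATZero X) {γ : ℝ → X} (hγ : Isometry γ) {z z' : X} {u u' : ℝ}
    (h : IsFoot γ z u) (h' : IsFoot γ z' u') : |u - u'| ≤ dist z z' := by
  have h1 := h.sq_le hX hγ u'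
  have h2 := h'.sq_le hX hγ u
  have h3 := hX.quadrilateral z (γ u) (γ u') z'
  rw [dist_comm (γ u) z', dist_comm (γ u') z', dist_line hγ] at h3
  have e : (u' - u) ^ 2 = |u - u'| ^ 2 := by rw [sq_abs]; ring
  rw [← sq_abs (u - u')] at h1
  rw [e] at h2
  rcases (abs_nonneg (u - u')).eq_or_lt with h0 | h0
  · rw [← h0]; exact dist_nonneg
  · have : |u - u'| * |u - u'| ≤ |u - u'| * dist z z' := by linarith
    exact le_of_mul_le_mul_left this h0

lemma IsFoot.ne (hX : IsCATZero X) {γ : ℝ → X} (hγ : Isometry γ) {z z' : X} {u u' : ℝ}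
    (h : IsFoot γ z u) (h' : IsFoot γ z' u') (hne : u ≠ u') : z ≠ z' := by
  rintro rfl
  have := h.abs_sub_le hX hγ h'
  rw [dist_self] at this
  exact hne (sub_eq_zero.1 (abs_nonpos_iff.1 this))

/-- By the Pythagorean inequality `IsFoot.sq_le`, a chord at distance `s` from the foot has length
at least √2 s, so every chord ratio is at least sin(π/4). -/
lemma IsFoot.pi_div_two_le_angle (hX : IsCATZero X) {γ : ℝ → X} (hγ : Isometry γ) {z : X} {u v : ℝ}
    (h : IsFoot γ z u) (hz : z ≠ γ u) (hv : v ≠ u) :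
    Real.pi / 2 ≤ angle (γ u) (γ v) z := by
  have hpi := Real.pi_pos
  have : Real.sin (Real.pi / 4) ≤ halfSin (γ u) (γ v) z := by
    refine hX.le_halfSin (hγ.injective.ne hv) hz fun a b ha e h1 h2 => ?_
    have hA : 0 < |v - u| := abs_pos.2 (sub_ne_zero.2 hv)
    have dv : dist (γ u) (γ v) = |v - u| := by rw [dist_comm, dist_line hγ]
    have hle : dist (γ u) a ≤ |v - u| := by
      rw [← dv]; linarith [dist_nonneg (x := a) (y := γ v)]
    set s := dist (γ u) a with hs
    have d1 : dist (γ u) (γ (u + s / |v - u| * (v - u))) = s := by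
      rw [dist_line hγ, sub_add_cancel_left, abs_neg, abs_mul, abs_div, abs_abs,
        abs_of_nonneg (hs ▸ dist_nonneg), div_mul_cancel₀ _ hA.ne']
    have d2 : dist (γ (u + s / |v - u| * (v - u))) (γ v) = |v - u| - s := by
      rw [dist_line hγ, show u + s / |v - u| * (v - u) - v
        = -((1 - s / |v - u|) * (v - u)) by ring, abs_neg, abs_mul, abs_of_nonneg, sub_mul,
        div_mul_cancel₀ _ hA.ne', one_mul]
      rw [sub_nonneg, div_le_one hA]
      exact hle
    have ea : a = γ (u + s / |v - u| * (v - u)) :=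
      hX.unique h1 (by rw [d1, d2, dv]; ring) (by rw [d1])
    have k := (h.of_btw h2).sq_le hX hγ (u + s / |v - u| * (v - u))
    rw [← ea, ← sq_abs (u - _), ← dist_line hγ u, d1, dist_comm b (γ u), ← e,
      dist_comm b a] at k
    rw [Real.sin_pi_div_four]
    refine (le_abs_self _).trans (abs_le_of_sq_le_sq ?_ dist_nonneg)
    have := Real.sq_sqrt (show (0 : ℝ) ≤ 2 by norm_num)
    calc (2 * s * (Real.sqrt 2 / 2)) ^ 2 = s ^ 2 * Real.sqrt 2 ^ 2 := by ring
      _ = s ^ 2 + s ^ 2 := by rw [this]; ring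
      _ ≤ _ := k
  have := Real.monotone_arcsin this
  rw [Real.arcsin_sin (by linarith) (by linarith)] at this
  rw [angle]
  linarith

/-! ### Right triangles in CAT(-1) balls -/

/-- Angles are at most the hyperbolic comparison angles inside a CAT(-1) ball. -/
lemma IsCATZero.angle_le_of_cosh_law (hX : IsCATZero X) {o p x y : X} {ε : ℝ}
    (hb : IsCATNegOne (Metric.ball o ε)) (hpo : p ∈ Metric.ball o ε) (hxo : x ∈ Metric.ball o ε)
    (hyo : y ∈ Metric.ball o ε) (hx : x ≠ p) (hy : y ≠ p) {t : ℝ} (h0 : 0 ≤ t)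
    (h1 : t ≤ Real.pi) (hball : ∀ v, dist p v + dist v y = dist p y → v ∈ Metric.ball o ε)
    (h : Real.sinh (dist p x) * Real.sinh (dist p y) * Real.cos t
      ≤ Real.cosh (dist p x) * Real.cosh (dist p y) - Real.cosh (dist x y)) :
    angle p x y ≤ t := by
  refine angle_le_of_halfSin_le h0 h1 ?_
  have px : 0 < dist p x := dist_pos.2 hx.symm
  have py : 0 < dist p y := dist_pos.2 hy.symm
  have hsin := Real.sin_nonneg_of_nonneg_of_le_pi (x := t / 2) (by linarith) (by linarith)
  have hcos : Real.cos t = 1 - 2 * Real.sin (t / 2) ^ 2 := by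
    conv_lhs => rw [show t = 2 * (t / 2) by ring]
    rw [Real.cos_two_mul, Real.cos_sq']; ring
  -- Hyperbolic chords carry an extra factor sinh(s)/s, which disappears as s tends to 0.
  have key : ∀ s, 0 < s → s < min (dist p x) (dist p y) →
      halfSin p x y ≤ Real.sinh s / s * Real.sin (t / 2) := by
    intro s s0 hs
    obtain ⟨u, u1, u2, u3⟩ := hX.exists_ne s0 (hs.le.trans (min_le_left _ _))
    obtain ⟨v, -, v2, v3⟩ := hX.exists_ne s0 (hs.le.trans (min_le_right _ _))
    refine halfSin_le u1 (u2.trans v2.symm) u3 v3 ?_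
    have k1 := hX.cosh_stewart hb hpo hxo (hball v v3) u3
    have k2 := hX.cosh_stewart hb hpo hyo hxo v3
    rw [show dist u x = dist p x - s by linarith, u2, dist_comm v p, v2, dist_comm v x,
      dist_comm v u, Real.sinh_sub] at k1
    rw [show dist v y = dist p y - s by linarith, v2, dist_comm x p, Real.sinh_sub] at k2
    have A0 := Real.sinh_pos_iff.2 px
    have B0 := Real.sinh_pos_iff.2 py
    have S0 := Real.sinh_pos_iff.2 s0
    have cs := Real.cosh_sq s
    have cd : Real.cosh (dist u v) = 1 + 2 * Real.sinh (dist u v / 2) ^ 2 := by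
      conv_lhs => rw [show dist u v = 2 * (dist u v / 2) by ring]
      rw [Real.cosh_two_mul, Real.cosh_sq]; ring
    have m1 := mul_le_mul_of_nonneg_left k1 B0.le
    have m2 := mul_le_mul_of_nonneg_left k2 S0.le
    have m3 := mul_le_mul_of_nonneg_left h (sq_nonneg (Real.sinh s))
    rw [hcos] at m3
    rw [cd] at m1
    have m4 : Real.sinh (dist p x) * Real.sinh (dist p y) * Real.sinh (dist u v / 2) ^ 2
        ≤ Real.sinh (dist p x) * Real.sinh (dist p y) *
          (Real.sinh s * Real.sin (t / 2)) ^ 2 := by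
      have := congrArg (fun c => c * (Real.sinh (dist p x) * Real.sinh (dist p y))) cs
      linarith
    have m5 : Real.sinh (dist u v / 2) ≤ Real.sinh s * Real.sin (t / 2) :=
      (le_abs_self _).trans (abs_le_of_sq_le_sq
        (le_of_mul_le_mul_left m4 (mul_pos A0 B0)) (mul_nonneg S0.le hsin))
    have m6 : dist u v / 2 ≤ Real.sinh (dist u v / 2) := Real.self_le_sinh_iff.2 (by positivity)
    rw [u2]
    calc dist u v ≤ 2 * (Real.sinh s * Real.sin (t / 2)) := by linarith
      _ = _ := by field_simp
  have lim : Filter.Tendsto (fun s => Real.sinh s / s * Real.sin (t / 2)) (nhdsWithin 0 (Ioi 0))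
      (nhds (1 * Real.sin (t / 2))) := by
    refine Filter.Tendsto.mul_const _ ?_
    have := (Real.hasDerivAt_sinh 0).tendsto_slope_zero_right
    simp only [zero_add, Real.sinh_zero, sub_zero, Real.cosh_zero, smul_eq_mul] at this
    exact this.congr fun s => by rw [div_eq_inv_mul]
  rw [one_mul] at lim
  refine ge_of_tendsto lim ?_
  filter_upwards [Ioo_mem_nhdsGT (lt_min px py)] with s hs using key s hs.1 hs.2

/-- In a CAT(-1) ball, the hypotenuse of a right triangle with equal legs. -/
lemma IsFoot.cosh_sq_le (hX : IsCATZero X) {γ : ℝ → X} (hγ : Isometry γ) {q : X} {u l ε : ℝ}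
    (hb : IsCATNegOne (Metric.ball (γ u) ε)) (h : IsFoot γ q u) (hl : 0 < l) (hlε : l < ε)
    (hq : dist (γ u) q = l) : Real.cosh l ^ 2 ≤ Real.cosh (dist (γ (u + l)) q) := by
  have da : dist (γ u) (γ (u + l)) = l := by
    rw [dist_line hγ, sub_add_cancel_left, abs_neg, abs_of_pos hl]
  -- First variation again: hyperbolic Stewart at parameter distance `s` from the foot, divided by
  -- sinh s, leaves an error that vanishes with `s`.
  have key : ∀ s, 0 < s → s < l → Real.cosh l ^ 2 - Real.cosh (dist (γ (u + l)) q)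
      ≤ Real.sinh l * Real.cosh l * Real.sinh (s / 2) := by
    intro s s0 hs
    have d1 : dist (γ u) (γ (u + s)) = s := by
      rw [dist_line hγ, sub_add_cancel_left, abs_neg, abs_of_pos s0]
    have d2 : dist (γ (u + s)) (γ (u + l)) = l - s := by
      rw [dist_line hγ, add_sub_add_left_eq_sub, abs_sub_comm, abs_of_pos (by linarith)]
    have k := hX.cosh_stewart hb (p := γ u) (q := γ (u + l)) (m := γ (u + s)) (w := q)
      (Metric.mem_ball_self (hl.trans hlε)) (by rw [Metric.mem_ball']; rwa [da])
      (by rw [Metric.mem_ball']; rwa [hq]) (by rw [d1, d2, da]; ring)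
    rw [d1, d2, da, dist_comm q (γ u), hq, dist_comm q (γ (u + l)), Real.sinh_sub] at k
    have k2 : Real.cosh l ≤ Real.cosh (dist q (γ (u + s))) := by
      rw [Real.cosh_le_cosh, abs_of_pos hl, abs_of_nonneg dist_nonneg, ← hq, dist_comm]
      exact h (u + s)
    have L0 := Real.sinh_pos_iff.2 hl
    have S0 := Real.sinh_pos_iff.2 s0
    have C0 := Real.cosh_pos l
    have cs : Real.cosh s - 1 ≤ Real.sinh s * Real.sinh (s / 2) := by
      have e1 : Real.cosh s = 1 + 2 * Real.sinh (s / 2) ^ 2 := by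
        conv_lhs => rw [show s = 2 * (s / 2) by ring]
        rw [Real.cosh_two_mul, Real.cosh_sq]; ring
      have e2 : Real.sinh s = 2 * Real.sinh (s / 2) * Real.cosh (s / 2) := by
        conv_lhs => rw [show s = 2 * (s / 2) by ring]
        rw [Real.sinh_two_mul]
      rw [e1, e2]
      nlinarith [Real.one_le_cosh (s / 2), sq_nonneg (Real.sinh (s / 2))]
    have m1 := mul_le_mul_of_nonneg_left k2 L0.le
    have m2 := mul_le_mul_of_nonneg_left cs (mul_pos L0 C0).le
    refine le_of_mul_le_mul_left (a := Real.sinh s) ?_ S0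
    linarith
  have lim : Filter.Tendsto (fun s => Real.sinh l * Real.cosh l * Real.sinh (s / 2))
      (nhdsWithin 0 (Ioi 0)) (nhds (Real.sinh l * Real.cosh l * Real.sinh (0 / 2))) :=
    Filter.Tendsto.mono_left (Continuous.tendsto (by fun_prop) 0) nhdsWithin_le_nhds
  rw [zero_div, Real.sinh_zero, mul_zero] at lim
  have : Real.cosh l ^ 2 - Real.cosh (dist (γ (u + l)) q) ≤ 0 := by
    refine ge_of_tendsto lim ?_
    filter_upwards [Ioo_mem_nhdsGT hl] with s hs using key s hs.1 hs.2
  linarith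

/-- This makes 3δ/4 an admissible leg: the hypotenuse is then at least δ, while the leg stays
strictly shorter than δ. With x = cosh(δ/2) the inequality is (x - 1)(4x² - 3) ≥ 0. -/
lemma cosh_le_cosh_sq (δ : ℝ) : Real.cosh δ ≤ Real.cosh (3 * δ / 4) ^ 2 := by
  have h3 : Real.cosh (3 * δ / 4) ^ 2 = (1 + Real.cosh (3 * (δ / 2))) / 2 := by
    rw [show 3 * (δ / 2) = 2 * (3 * δ / 4) by ring, Real.cosh_two_mul, Real.sinh_sq]; ring
  have h2 : Real.cosh δ = 2 * Real.cosh (δ / 2) ^ 2 - 1 := by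
    conv_lhs => rw [show δ = 2 * (δ / 2) by ring]
    rw [Real.cosh_two_mul, Real.sinh_sq]; ring
  rw [h3, h2, Real.cosh_three_mul]
  have := Real.one_le_cosh (δ / 2)
  nlinarith [mul_nonneg (sub_nonneg.2 this) (sub_nonneg.2 (one_le_pow₀ this (n := 2)))]

/-- The base angle of the hyperbolic isosceles right triangle with hypotenuse `δ`. -/
noncomputable def baseAngle (δ : ℝ) : ℝ :=
  Real.arccos (Real.sqrt (Real.cosh δ / (Real.cosh δ + 1)))

/-- This is the cosine law with `baseAngle δ` in place of the comparison angle. It holds because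
c/(c + 1) increases with c and the hypotenuse `D` is at least the model one; after squaring it
reduces to `h2`. -/
lemma sinh_mul_cos_baseAngle_le {δ l D : ℝ}
    (h1 : Real.cosh δ ≤ Real.cosh l ^ 2) (h2 : Real.cosh l ^ 2 ≤ Real.cosh D) :
    Real.sinh l * Real.sinh D * Real.cos (baseAngle δ)
      ≤ Real.cosh l * Real.cosh D - Real.cosh l := by
  have e0 := Real.cosh_pos δ
  have hle : Real.cosh δ / (Real.cosh δ + 1) ≤ Real.cosh l ^ 2 / (Real.cosh l ^ 2 + 1) := by
    rw [div_le_div_iff₀ (by positivity) (by positivity)]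
    linarith
  have hc : Real.cos (baseAngle δ) ^ 2 = Real.cosh δ / (Real.cosh δ + 1) := by
    rw [baseAngle, Real.cos_arccos, Real.sq_sqrt (by positivity)]
    · linarith [Real.sqrt_nonneg (Real.cosh δ / (Real.cosh δ + 1))]
    · refine Real.sqrt_le_one.2 ?_
      rw [div_le_one (by positivity)]
      linarith
  have D1 := Real.one_le_cosh D
  have L1 := Real.one_le_cosh l
  refine (le_abs_self _).trans (abs_le_of_sq_le_sq ?_ (by nlinarith))
  rw [mul_pow, hc]
  refine (mul_le_mul_of_nonneg_left hle (sq_nonneg _)).trans ?_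
  rw [mul_pow, Real.sinh_sq, Real.sinh_sq, mul_div_assoc', div_le_iff₀ (by positivity)]
  generalize Real.cosh D = d at *
  generalize Real.cosh l = c at *
  have : 0 ≤ c ^ 2 * (d - 1) * (2 * (d - c ^ 2)) :=
    mul_nonneg (mul_nonneg (sq_nonneg _) (by linarith)) (by linarith)
  linarith

lemma baseAngle_nonneg (δ : ℝ) : 0 ≤ baseAngle δ := Real.arccos_nonneg _

lemma baseAngle_le_pi (δ : ℝ) : baseAngle δ ≤ Real.pi := Real.arccos_le_pi _

/-- The strict inequality is what makes the angle loss per strip positive; at δ = 0 the Euclidean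
value π/4 would give none. -/
lemma baseAngle_lt {δ : ℝ} (hδ : 0 < δ) : baseAngle δ < Real.pi / 4 := by
  have hc : 1 < Real.cosh δ := Real.one_lt_cosh.2 hδ.ne'
  have hpi := Real.pi_pos
  rw [baseAngle, ← Real.arccos_cos (x := Real.pi / 4) (by linarith) (by linarith)]
  refine Real.arccos_lt_arccos ?_ ?_ ?_
  · rw [Real.cos_pi_div_four]
    linarith [Real.sqrt_nonneg 2]
  · rw [Real.cos_pi_div_four]
    refine Real.lt_sqrt_of_sq_lt ?_
    rw [div_pow, Real.sq_sqrt (by norm_num), lt_div_iff₀ (by linarith)]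
    linarith
  · refine Real.sqrt_le_one.2 ?_
    rw [div_le_one (by linarith)]
    linarith

/-- The two acute angles of the triangle cut off near a point of the line with a CAT(-1)
neighbourhood. -/
lemma IsFoot.angle_le_baseAngle (hX : IsCATZero X) {γ : ℝ → X} (hγ : Isometry γ) {q : X}
    {u l ε δ : ℝ} (hb : IsCATNegOne (Metric.ball (γ u) ε)) (h : IsFoot γ q u) (hl : 0 < l)
    (hlε : l < ε) (hδ : Real.cosh δ ≤ Real.cosh l ^ 2) (hq : dist (γ u) q = l) :
    angle (γ (u + l)) q (γ u) ≤ baseAngle δ ∧ angle q (γ (u + l)) (γ u) ≤ baseAngle δ := by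
  have da : dist (γ u) (γ (u + l)) = l := by
    rw [dist_line hγ, sub_add_cancel_left, abs_neg, abs_of_pos hl]
  have hD := h.cosh_sq_le hX hγ hb hl hlε hq
  have hne : q ≠ γ (u + l) := h.ne hX hγ (isFoot_self γ _) (by linarith)
  have hqu : γ u ≠ q := by rw [← dist_pos, hq]; exact hl
  have hau : γ u ≠ γ (u + l) := by rw [← dist_pos, da]; exact hl
  have mu : γ u ∈ Metric.ball (γ u) ε := Metric.mem_ball_self (hl.trans hlε)
  have ma : γ (u + l) ∈ Metric.ball (γ u) ε := by rw [Metric.mem_ball']; rwa [da]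
  have mq : q ∈ Metric.ball (γ u) ε := by rw [Metric.mem_ball']; rwa [hq]
  have key := sinh_mul_cos_baseAngle_le hδ hD
  constructor
  · refine hX.angle_le_of_cosh_law hb ma mq mu hne hau (baseAngle_nonneg δ) (baseAngle_le_pi δ)
      (fun v hv => ?_) ?_
    · rw [Metric.mem_ball]
      rw [dist_comm (γ (u + l)) (γ u), da] at hv
      linarith [dist_nonneg (x := γ (u + l)) (y := v)]
    · rw [dist_comm (γ (u + l)) (γ u), da, dist_comm q (γ u), hq]
      linarith
  · refine hX.angle_le_of_cosh_law hb mq ma mu hne.symm hqu (baseAngle_nonneg δ)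
      (baseAngle_le_pi δ) (fun v hv => ?_) ?_
    · rw [Metric.mem_ball]
      rw [dist_comm q (γ u), hq] at hv
      linarith [dist_nonneg (x := q) (y := v)]
    · rw [dist_comm (γ (u + l)) (γ u), da, dist_comm q (γ u), hq, dist_comm q]
      linarith

/-! ### Angle loss along a geodesic -/

/-- A strip between two fibres of the projection onto the line, one of which starts in a CAT(-1)
ball, has a definite angle deficit. -/
lemma IsFoot.strip_angle_le (hX : IsCATZero X) {γ : ℝ → X} (hγ : Isometry γ) {z z' : X}
    {u u' l ε δ : ℝ} (hb : IsCATNegOne (Metric.ball (γ u) ε)) (h : IsFoot γ z u)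
    (h' : IsFoot γ z' u') (hl : 0 < l) (hlε : l < ε) (hδ : Real.cosh δ ≤ Real.cosh l ^ 2)
    (hz : l < dist (γ u) z) (hz' : γ u' ≠ z') (hu : u + l < u') :
    angle z (γ u) z' + angle z' z (γ u') ≤ Real.pi / 2 + 2 * baseAngle δ := by
  obtain ⟨q, q1, q2, q3⟩ := hX.exists_ne hl hz.le
  have hq : IsFoot γ q u := h.of_btw q3
  obtain ⟨b1, b2⟩ := hq.angle_le_baseAngle hX hγ hb hl hlε hδ q2
  have ha : IsFoot γ (γ (u + l)) (u + l) := isFoot_self γ _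
  have hp' : IsFoot γ (γ u') u' := isFoot_self γ _
  have hqz : q ≠ z := by
    rintro rfl
    exact hz.ne' q2
  have hqa : q ≠ γ (u + l) := hq.ne hX hγ ha (by linarith)
  have hqz' : q ≠ z' := hq.ne hX hγ h' (by linarith)
  have haz' : γ (u + l) ≠ z' := ha.ne hX hγ h' (by linarith)
  have hap' : γ (u + l) ≠ γ u' := ha.ne hX hγ hp' (by linarith)
  have hpa : γ u ≠ γ (u + l) := (isFoot_self γ u).ne hX hγ ha (by linarith)
  have hzz' : z ≠ z' := h.ne hX hγ h' (by linarith)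
  have s1 := hX.pi_le_angle_add_angle (p := q) (x := z) (y := γ u) (w := γ (u + l)) hqz.symm
    q1.symm hqa.symm (btw_comm q3)
  have s2 := hX.pi_le_angle_add_angle (p := γ (u + l)) (x := γ u) (y := γ u') (w := q) hpa
    hap'.symm hqa (by
      simp only [dist_line hγ]
      rw [abs_of_neg (by linarith), abs_of_neg (by linarith), abs_of_neg (by linarith)]
      ring)
  have s3 := h'.pi_div_two_le_angle hX hγ hz'.symm (v := u + l) (by linarith)
  -- Three triangles with apex `z'` fill the strip minus its corner triangle, for a total of at most
  -- 3π. The angles at `q` and `γ (u + l)` take at least π - α each and the one at `γ u'` at least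
  -- π/2, leaving π/2 + 2α.
  have t1 := hX.angle_sum_le (p := z') (q := γ u') (r := γ (u + l)) hz'.symm hap'.symm haz'
  have t2 := hX.angle_sum_le (p := z') (q := γ (u + l)) (r := q) haz'.symm hqa.symm hqz'
  have t3 := hX.angle_sum_le (p := z') (q := q) (r := z) hqz'.symm hqz hzz'
  have v1 := hX.angle_triangle (p := γ (u + l)) (x := q) (y := z') (z := γ u') hqa haz'.symm
    hap'.symm
  have v2 := hX.angle_triangle (p := q) (x := z) (y := z') (z := γ (u + l)) hqz.symm hqz'.symm
    hqa.symm
  have v3 := hX.angle_triangle (p := z') (x := z) (y := q) (z := γ u') hzz' hqz' hz'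
  have v4 := hX.angle_triangle (p := z') (x := q) (y := γ (u + l)) (z := γ u') hqz' haz' hz'
  have v5 := hX.angle_le_of_btw (p := z) (x := q) (z := γ u) (y := z') hqz hzz'.symm (btw_comm q3)
  linarith [angle_comm (γ (u + l)) (γ u) q, angle_comm (γ (u + l)) z' (γ u'),
    angle_comm z' (γ (u + l)) (γ u'), angle_comm (γ u') (γ (u + l)) z',
    angle_comm (γ (u + l)) q z', angle_comm q z z', angle_comm q z' (γ (u + l)),
    angle_comm z' q (γ (u + l)), angle_comm z q z', angle_comm z' z q]

/-- The projection onto the line takes all intermediate values along a geodesic. -/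
lemma IsFoot.exists_btw (hX : IsCATZero X) {γ : ℝ → X} (hγ : Isometry γ) {x y : X} {a b t : ℝ}
    (hx : IsFoot γ x a) (hy : IsFoot γ y b) (hat : a ≤ t) (htb : t ≤ b) :
    ∃ z, dist x z + dist z y = dist x y ∧ IsFoot γ z t := by
  obtain ⟨S, c, c0, c1, hc, -⟩ := hX.1 x y
  choose f hf using fun z => exists_isFoot hγ z
  have huniq : ∀ z u, IsFoot γ z u → f z = u := by
    intro z u hu
    by_contra hne
    exact (hf z).ne hX hγ hu hne rfl
  have hcont : ContinuousOn (fun s => f (c s)) (Icc 0 (dist x y)) := by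
    refine LipschitzOnWith.continuousOn (K := 1) (LipschitzOnWith.of_dist_le_mul ?_)
    intro s hs r hr
    rw [NNReal.coe_one, one_mul, Real.dist_eq, Real.dist_eq, ← hc s hs r hr]
    exact (hf _).abs_sub_le hX hγ (hf _)
  obtain ⟨s, hs, hst⟩ := intermediate_value_Icc dist_nonneg hcont
    (show t ∈ Icc (f (c 0)) (f (c (dist x y))) by
      rw [c0, c1, huniq x a hx, huniq y b hy]; exact ⟨hat, htb⟩)
  have d1 := hc 0 ⟨le_rfl, dist_nonneg⟩ s hs
  have d2 := hc s hs (dist x y) ⟨dist_nonneg, le_rfl⟩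
  rw [c0, zero_sub, abs_neg, abs_of_nonneg hs.1] at d1
  rw [c1, abs_of_nonpos (by linarith [hs.2])] at d2
  refine ⟨c s, by rw [d1, d2]; ring, ?_⟩
  simp only at hst
  rw [← hst]
  exact hf (c s)

/-- If `[x, y]` is shorter than the distance from `x` to the line, the line has room for only few
CAT(-1) balls between the projections of `x` and `y`. -/
lemma IsFoot.angle_descent (hX : IsCATZero X) {γ : ℝ → X} (hγ : Isometry γ) {x y : X}
    {a b l ε δ : ℝ} (hx : IsFoot γ x a) (hy : IsFoot γ y b) (hxy : dist x y < dist x (γ a))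
    (hl : 0 < l) (hlε : l < ε) (hδ : Real.cosh δ ≤ Real.cosh l ^ 2) {τ : ℕ → ℝ}
    (hτ : ∀ n, τ n + l < τ (n + 1)) (hτa : a < τ 0)
    (hcat : ∀ n, IsCATNegOne (Metric.ball (γ (τ n)) ε)) (n : ℕ) (hn : τ n + l ≤ b) :
    ∃ z w, IsFoot γ z (τ n) ∧ dist x z + dist z y = dist x y ∧ dist w z + dist z y = dist w y ∧
      w ≠ z ∧ angle z w (γ (τ n)) ≤ Real.pi - n * (Real.pi / 2 - 2 * baseAngle δ) := by
  -- The height of `z` exceeds d(z, y), because [x, y] is shorter than the distance from `x` to the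
  -- line; and d(z, y) ≥ b - τ m ≥ l since projection is 1-Lipschitz.
  have height : ∀ m z, τ m + l ≤ b → IsFoot γ z (τ m) → dist x z + dist z y = dist x y →
      l < dist (γ (τ m)) z := by
    intro m z hm hz hxz
    have h1 := hx (τ m)
    have h2 := dist_triangle_right x (γ (τ m)) z
    have h3 := hz.abs_sub_le hX hγ hy
    rw [abs_of_neg (by linarith)] at h3
    linarith
  induction n with
  | zero =>
    obtain ⟨z, z1, z2⟩ := hx.exists_btw hX hγ hy hτa.le (by linarith)
    refine ⟨z, x, z2, z1, z1, hx.ne hX hγ z2 hτa.ne, ?_⟩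
    rw [Nat.cast_zero, zero_mul, sub_zero]
    exact angle_le_pi _ _ _
  | succ n ih =>
    have hlt := hτ n
    obtain ⟨z, w, i1, i2, i3, i4, i5⟩ := ih (by linarith)
    obtain ⟨z', z1, z2⟩ := i1.exists_btw hX hγ hy (t := τ (n + 1)) (by linarith) (by linarith)
    have hne : z ≠ z' := i1.ne hX hγ z2 (by linarith)
    have hxz' : dist x z' + dist z' y = dist x y :=
      btw_comm (btw_trans (btw_comm z1) (btw_comm i2))
    have hz := height n z (by linarith) i1 i2
    have hz' := height (n + 1) z' hn z2 hxz'
    refine ⟨z', z, z2, hxz', z1, hne, ?_⟩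
    have k1 := i1.strip_angle_le hX hγ (hcat n) z2 hl hlε hδ hz
      (dist_pos.1 (hl.trans hz')) hlt
    have k2 := hX.pi_le_angle_add_angle (p := z) (x := w) (y := z') (w := γ (τ n)) i4 hne.symm
      (dist_pos.1 (hl.trans hz)) (btw_comm (btw_trans_right (btw_comm z1) (btw_comm i3)))
    push_cast
    linarith

/-! ### Counting strips -/

lemma eta_mul_eq {δ : ℝ} (hδ : 0 < δ) : eta δ * (Real.pi / 2 - 2 * baseAngle δ) = Real.pi := by
  have h := baseAngle_lt hδ
  have : Real.pi - 4 * baseAngle δ ≠ 0 := by linarith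
  rw [eta, ← baseAngle]
  field_simp
  ring

lemma eta_pos {δ : ℝ} (hδ : 0 < δ) : 0 < eta δ := by
  have h := baseAngle_lt hδ
  refine pos_of_mul_pos_left ?_ (show 0 ≤ Real.pi / 2 - 2 * baseAngle δ by linarith)
  rw [eta_mul_eq hδ]
  exact Real.pi_pos

/-- The sequence along the line, from the first time after `a`. -/
lemma exists_first_gt {t : ℤ → ℝ} {R L : ℝ} (hR : 0 < R) (hlow : ∀ n, t n + R ≤ t (n + 1))
    (hupp : ∀ n, t (n + 1) ≤ t n + L) (a : ℝ) : ∃ m : ℤ, a < t m ∧ t m ≤ a + L := by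
  -- Gaps of at least `R` make the times unbounded in both directions, so there is a least index
  -- past `a`.
  have up : ∀ n : ℕ, t 0 + n * R ≤ t n := by
    intro n
    induction n with
    | zero => simp
    | succ n ih => have := hlow n; push_cast; linarith
  have down : ∀ n : ℕ, t (-n) ≤ t 0 - n * R := by
    intro n
    induction n with
    | zero => simp
    | succ n ih =>
      have := hlow (-(n + 1 : ℤ))
      rw [show (-(n + 1 : ℤ)) + 1 = -n by ring] at this
      push_cast
      linarith
  have mono : Monotone t := monotone_int_of_le_succ fun n => by linarith [hlow n]
  obtain ⟨N, hN⟩ := exists_nat_gt ((a - t 0) / R)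
  obtain ⟨M, hM⟩ := exists_nat_gt ((t 0 - a) / R)
  rw [div_lt_iff₀ hR] at hN hM
  obtain ⟨m, hm, hmin⟩ := Int.exists_least_of_bdd (P := fun n => a < t n)
    ⟨-M, fun n hn => by
      by_contra! hlt
      have := mono hlt.le
      linarith [down M]⟩ ⟨N, by linarith [up N]⟩
  refine ⟨m, hm, ?_⟩
  have h1 : t (m - 1) ≤ a := by
    by_contra! hlt
    have := hmin _ hlt
    linarith
  have h2 := hupp (m - 1)
  rw [sub_add_cancel] at h2
  linarith

/-- If the feet were farther apart, more than `eta δ` strips would fit between them and the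
descending angle would become negative. -/
lemma IsFoot.sub_le (hX : IsCATZero X) {γ : ℝ → X} (hγ : Isometry γ) {x y : X} {a b δ ε R L : ℝ}
    (hx : IsFoot γ x a) (hy : IsFoot γ y b) (hxy : dist x y < dist x (γ a)) (hδ : 0 < δ)
    (hδε : δ ≤ ε) (hδR : 2 * δ < R) {t : ℤ → ℝ} (hlow : ∀ n, t n + R ≤ t (n + 1))
    (hupp : ∀ n, t (n + 1) ≤ t n + L) (hcat : ∀ n, IsCATNegOne (Metric.ball (γ (t n)) ε)) :
    b - a ≤ (eta δ + 2) * L + 3 * δ / 2 := by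
  by_contra! hlt
  have hL : 0 < L := by linarith [hlow 0, hupp 0]
  obtain ⟨m, hm1, hm2⟩ := exists_first_gt (by linarith) hlow hupp a
  have hτ : ∀ n : ℕ, t (m + n) ≤ a + (n + 1) * L := by
    intro n
    induction n with
    | zero => simpa using hm2
    | succ n ih =>
      have := hupp (m + n)
      rw [add_assoc] at this
      push_cast
      linarith
  have hfl := Nat.floor_le (eta_pos hδ).le
  have hlt' := Nat.lt_floor_add_one (eta δ)
  -- The index ⌊η⌋ + 1 is the first integer above η, and its time is at most a + (⌊η⌋ + 2) L. The
  -- leg 3δ/4 fits in the open ball even when δ = ε.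
  obtain ⟨z, w, -, -, -, -, hz⟩ := hx.angle_descent hX hγ hy hxy (l := 3 * δ / 4) (ε := ε) (δ := δ)
    (by linarith) (by linarith) (cosh_le_cosh_sq δ) (τ := fun n : ℕ => t (m + n))
    (fun n => by
      have := hlow (m + n)
      rw [add_assoc] at this
      push_cast
      linarith) (by simpa using hm1) (fun n => hcat _) (⌊eta δ⌋₊ + 1) (by
      have h1 := hτ (⌊eta δ⌋₊ + 1)
      have h2 : ((⌊eta δ⌋₊ + 1 : ℕ) + 1 : ℝ) * L ≤ (eta δ + 2) * L := by
        push_cast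
        refine mul_le_mul_of_nonneg_right (by linarith) hL.le
      linarith)
  have h0 := angle_nonneg z w (γ (t (m + (⌊eta δ⌋₊ + 1 : ℕ))))
  have hk : 0 < Real.pi / 2 - 2 * baseAngle δ := by linarith [baseAngle_lt hδ]
  have := mul_lt_mul_of_pos_right hlt' hk
  rw [eta_mul_eq hδ] at this
  push_cast at hz h0
  linarith

lemma isFoot_of_mem_nearestPoints {γ : ℝ → X} {z p : X} (h : p ∈ nearestPoints (range γ) z) :
    ∃ u, γ u = p ∧ IsFoot γ z u := by
  obtain ⟨⟨u, rfl⟩, hu⟩ := h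
  exact ⟨u, rfl, fun v => hu.trans_le (Metric.infDist_le_dist_of_mem (mem_range_self v))⟩

lemma isContractingWith_range (hX : IsCATZero X) {γ : ℝ → X} (hγ : Isometry γ) {δ ε R L : ℝ}
    (hδ : 0 < δ) (hδε : δ ≤ ε) (hδR : 2 * δ < R) {t : ℤ → ℝ} (hlow : ∀ n, t n + R ≤ t (n + 1))
    (hupp : ∀ n, t (n + 1) ≤ t n + L) (hcat : ∀ n, IsCATNegOne (Metric.ball (γ (t n)) ε)) :
    IsContractingWith (range γ) (2 * (eta δ + 2) * L + 3 * δ) := by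
  have hL : 0 < L := by linarith [hlow 0, hupp 0]
  have he := eta_pos hδ
  refine ⟨by positivity, fun x r hdisj => ?_⟩
  obtain ⟨a, ha⟩ := exists_isFoot hγ x
  have key : ∀ p ∈ ⋃ y ∈ Metric.ball x r, nearestPoints (range γ) y,
      dist p (γ a) ≤ (eta δ + 2) * L + 3 * δ / 2 := by
    intro p hp
    simp only [mem_iUnion, exists_prop] at hp
    obtain ⟨y, hy, hyp⟩ := hp
    obtain ⟨b, rfl, hb⟩ := isFoot_of_mem_nearestPoints hyp
    have hxy : dist x y < dist x (γ a) := by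
      rw [Metric.mem_ball'] at hy
      refine hy.trans_le ?_
      by_contra! hlt
      exact disjoint_left.1 hdisj (Metric.mem_ball'.2 hlt) (mem_range_self a)
    rw [dist_line hγ]
    refine abs_le.2 ⟨?_, ha.sub_le hX hγ hb hxy hδ hδε hδR hlow hupp hcat⟩
    -- The reversed line with times -t(-n) satisfies the same hypotheses, so the one-sided bound
    -- also controls a - b.
    have hrev : ∀ z u, IsFoot γ z u → IsFoot (fun v => γ (-v)) z (-u) := by
      intro z u hu v
      simpa using hu (-v)
    have k := (hrev x a ha).sub_le hX (γ := fun v => γ (-v)) (t := fun n => -t (-n)) (L := L)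
      (hγ.comp (IsometryEquiv.neg ℝ).isometry) (hrev y b hb) (by simpa using hxy) hδ hδε hδR
      (fun n => by
        have := hlow (-(n + 1))
        rw [neg_add_rev, neg_add_cancel_comm] at this
        simp only [neg_add_rev]
        linarith)
      (fun n => by
        have := hupp (-(n + 1))
        rw [neg_add_rev, neg_add_cancel_comm] at this
        simp only [neg_add_rev]
        linarith)
      (fun n => by
        rw [neg_neg]
        exact hcat (-n))
    linarith
  intro p hp q hq
  have := dist_triangle_right p q (γ a)
  linarith [key p hp, key q hq]

end PartiallyCAT

theorem proposition3p5 {X : Type*} [MetricSpace X] (hX : PartiallyCAT.IsCATZero X)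
    (γ : ℝ → X) (hγ : Isometry γ)
    (ε R L : ℝ) (hε : 0 < ε) (hR : 0 < R)
    (t : ℤ → ℝ) (ht : StrictMono t)
    (hlow : ∀ n : ℤ, R ≤ dist (γ (t n)) (γ (t (n + 1))))
    (hupp : ∀ n : ℤ, dist (γ (t n)) (γ (t (n + 1))) ≤ L)
    (hcat : ∀ n : ℤ, PartiallyCAT.IsCATNegOne (Metric.ball (γ (t n)) ε)) :
    PartiallyCAT.IsContracting (Set.range γ) ∧
      ∀ δ : ℝ, 0 < δ → δ ≤ ε → 2 * δ < R →
        PartiallyCAT.IsContractingWith (Set.range γ)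
          (2 * (PartiallyCAT.eta δ + 2) * L + 3 * δ) := by
  have hd : ∀ n : ℤ, dist (γ (t n)) (γ (t (n + 1))) = t (n + 1) - t n := by
    intro n
    rw [hγ.dist_eq, dist_comm, Real.dist_eq, abs_of_pos (sub_pos.2 (ht (lt_add_one n)))]
  have main : ∀ δ : ℝ, 0 < δ → δ ≤ ε → 2 * δ < R →
      PartiallyCAT.IsContractingWith (Set.range γ)
        (2 * (PartiallyCAT.eta δ + 2) * L + 3 * δ) := fun δ h1 h2 h3 =>
    PartiallyCAT.isContractingWith_range hX hγ h1 h2 h3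
      (fun n => by linarith [hlow n, hd n]) (fun n => by linarith [hupp n, hd n]) hcat
  -- R/3 is a convenient cap, as 2R/3 < R.
  refine ⟨⟨_, main (min ε (R / 3)) (lt_min hε (by linarith)) (min_le_left _ _) ?_⟩, main⟩
  linarith [min_le_right ε (R / 3)]
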